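/- **Setting.** A finite action set $A$, a target action $a^*\in A$, action costs $c:A\to\mathbb R$, a signal space $X\subseteq\mathbb R^d$, and for each action $a$ a Borel probability measure $\mu_a$ on $X$. For distinct $a,a'$: $\mu_a\neq\mu_{a'}$, $\mu_{a'}\ll\mu_a$, and $\int \big(\frac{d\mu_{a'}}{d\mu_a}\big)^{\lambda}d\mu_a<\infty$ for all $\lambda>0$. The lowest wage is $\underline w\in\mathbb R$, and $u:[\underline w,\infty)\to\mathbb R$ is twice continuously differentiable with $u'>0$, $u''<0$ and $\lim_{w\to\infty}u'(w)=0$; let $h:=u^{-1}$. Assume $c(a)<c(a^*)$ for some $a$, and $c(a)\ne c(a^*)$ for all $a\neq a^*$. Let $\mathbb E_a$ be the expectation over $x^n=(x_1,\dots,x_n)$ drawn i.i.d. from $\mu_a$. The second-best cost $C_n^{\rm SB}$ is the infimum of $\mathbb E_{a^*}[w(x^n)]$ over measurable wage schemes $w:X^n\to[\underline w,\infty)$ that satisfy $$\mathbb E_{a^*}[u(w(x^n))]-c(a^*)\ge \mathbb E_a[u(w(x^n))]-c(a)\ \ \forall a\in A,\qquad \mathbb E_{a^*}[u(w(x^n))]-c(a^*)\ge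 0,$$ and $C_n^{\rm bin}$ is the same infimum over those $w$ that take exactly two values. The first-best cost $C^{\rm FB}$ is the minimal cost of implementing $a^*$ under perfect monitoring, i.e. the infimum of $w(a^*)$ over $w:A\to[\underline w,\infty)$ with $u(w(a^*))-c(a^*)\ge u(w(a))-c(a)$ for all $a$ and $u(w(a^*))-c(a^*)\ge0$. Let ${\rm KL}$ be the Kullback–Leibler divergence and ${\rm Ch}(\mu_0,\mu_1):=\min_{\nu}\max\{{\rm KL}(\nu,\mu_0),{\rm KL}(\nu,\mu_1)\}$, over Borel probability measures $\nu$ on $X$, the Chernoff distance. **Theorem 2.** (a) *Binary actions.* Let $A=\{0,1\}$, $a^*=1$, $c(0)<c(1)$. Assume severe limited liability, $u(\underline w)\ge c(0)$, and $u(\underline w)+c(1)-c(0)<\lim_{w\to\infty}u(w)$. Then $C^{\rm FB}=h(u(\underline w)+c(1)-c(0))$, $\;0<{\rm Ch}(\mu_0,\mu_1)<\infty$, and as $n\to\infty$ $$C^{\rm SB}_n-C^{\rm FB}=\exp[-{\rm Ch}(\mu_0,\mu_1)\,n+o(n)],\qquad C^{\rm bin}_n-C^{\rm FB}=\exp[-{\rm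 Ch}(\mu_0,\mu_1)\,n+o(n)].$$ (b) *Finitely many actions.* Let $A$ be finite, with a unique action $\hat a$ of least cost $c$. Assume $u(\underline w)\ge c(\hat a)$ and $u(\underline w)+c(a^*)-c(\hat a)<\lim_{w\to\infty}u(w)$. Let $$\rho:=\min\Big\{{\rm Ch}(\mu_{\hat a},\mu_{a^*}),\ \min_{a\ne\hat a:\ c(a)<c(a^*)}{\rm KL}(\mu_a,\mu_{a^*})\Big\},$$ where a minimum over the empty set is $\infty$. Then $C^{\rm FB}=h(u(\underline w)+c(a^*)-c(\hat a))$, $\;0<\rho<\infty$, and as $n\to\infty$ $$C^{\rm SB}_n-C^{\rm FB}=\exp[-\rho\, n+o(n)],\qquad C^{\rm bin}_n-C^{\rm FB}=\exp[-\rho\, n+o(n)].$$ -/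

import Mathlib

open MeasureTheory Filter Topology Asymptotics
open scoped ENNReal

namespace MoralHazard

section Definitions

variable {A X : Type*} [MeasurableSpace X]

/-- The distribution on `X ^ n` of `n` i.i.d. draws from `ν`. -/
noncomputable def iidLaw (n : ℕ) (ν : Measure X) : Measure (Fin n → X) :=
  Measure.pi fun _ => ν

/-- A monitoring technology: every action induces a probability distribution over signals;
distinct actions have distinct, mutually absolutely continuous distributions; and all positive
moments of the likelihood ratios are finite. -/
structure IsMonitoringTechnology (μ : A → Measure X) : Prop where
  prob : ∀ a, IsProbabilityMeasure (μ a)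
  identified : ∀ a a', a ≠ a' → μ a ≠ μ a'
  absCont : ∀ a a', a ≠ a' → μ a' ≪ μ a
  moments : ∀ a a', a ≠ a' → ∀ t : ℝ, 0 < t →
    ∫⁻ x, ((μ a').rnDeriv (μ a) x) ^ t ∂(μ a) < ⊤

/-- A consumption utility on `[wmin, ∞)`: twice continuously differentiable with `u' > 0`,
`u'' < 0`, and `u'(w) → 0` as `w → ∞`. Only the values of `u` on `[wmin, ∞)` matter. -/
structure IsUtility (u : ℝ → ℝ) (wmin : ℝ) : Prop where
  contDiffOn : ContDiffOn ℝ 2 u (Set.Ici wmin)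
  deriv_pos : ∀ w ∈ Set.Ici wmin, 0 < derivWithin u (Set.Ici wmin) w
  deriv2_neg : ∀ w ∈ Set.Ici wmin, iteratedDerivWithin 2 u (Set.Ici wmin) w < 0
  deriv_tendsto : Tendsto (derivWithin u (Set.Ici wmin)) atTop (𝓝 0)

/-- The inverse `h = u⁻¹` of the utility function `u : [wmin, ∞) → ℝ`. -/
noncomputable def invUtility (u : ℝ → ℝ) (wmin : ℝ) : ℝ → ℝ :=
  Function.invFunOn u (Set.Ici wmin)

/-- A wage scheme `w : X ^ n → [wmin, ∞)` that implements `astar`: it is incentive compatible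
and individually rational. The integrability requirements say that the expectations are finite
(wages are bounded below, so they always exist in `(-∞, ∞]`): a scheme of infinite expected wage
does not affect the minimal cost, and one of finite expected wage has finite expected utility
under `astar` (`u` is concave), hence violates incentive compatibility if its expected utility
under some other action is infinite. -/
structure Implements (μ : A → Measure X) (u : ℝ → ℝ) (wmin : ℝ) (c : A → ℝ) (astar : A)
    (n : ℕ) (w : (Fin n → X) → ℝ) : Prop where
  measurable : Measurable w
  lower_bound : ∀ x, wmin ≤ w x
  integrable_wage : Integrable w (iidLaw n (μ astar))
  integrable_utility : ∀ a, Integrable (fun x => u (w x)) (iidLaw n (μ a))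
  ic : ∀ a, (∫ x, u (w x) ∂(iidLaw n (μ a))) - c a ≤
    (∫ x, u (w x) ∂(iidLaw n (μ astar))) - c astar
  ir : 0 ≤ (∫ x, u (w x) ∂(iidLaw n (μ astar))) - c astar

/-- The second-best cost with `n` signals: the infimum (`⊤` if there is no admissible scheme) of
the expected wage over all wage schemes that implement `astar`. -/
noncomputable def secondBestCost (μ : A → Measure X) (u : ℝ → ℝ) (wmin : ℝ) (c : A → ℝ)
    (astar : A) (n : ℕ) : EReal :=
  ⨅ (w : (Fin n → X) → ℝ) (_ : Implements μ u wmin c astar n w),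
    ((∫ x, w x ∂(iidLaw n (μ astar)) : ℝ) : EReal)

/-- The second-best cost when only binary contracts, i.e. wage schemes with exactly two values,
are allowed. -/
noncomputable def binaryCost (μ : A → Measure X) (u : ℝ → ℝ) (wmin : ℝ) (c : A → ℝ)
    (astar : A) (n : ℕ) : EReal :=
  ⨅ (w : (Fin n → X) → ℝ)
    (_ : Implements μ u wmin c astar n w ∧ (Set.range w).ncard = 2),
    ((∫ x, w x ∂(iidLaw n (μ astar)) : ℝ) : EReal)

/-- The first-best cost: the minimal cost of implementing `astar` under perfect monitoring, where
the wage is a function of the action itself. -/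
noncomputable def firstBestCost (u : ℝ → ℝ) (wmin : ℝ) (c : A → ℝ) (astar : A) : EReal :=
  ⨅ (w : A → ℝ) (_ : (∀ a, wmin ≤ w a) ∧
      (∀ a, u (w a) - c a ≤ u (w astar) - c astar) ∧ 0 ≤ u (w astar) - c astar),
    ((w astar : ℝ) : EReal)

/-- The Chernoff distance: the minimum over probability measures `ν` of the larger of the two
Kullback-Leibler divergences from `ν`. -/
noncomputable def chernoff (μ₀ μ₁ : Measure X) : ℝ≥0∞ :=
  ⨅ (ν : Measure X) (_ : IsProbabilityMeasure ν),
    max (InformationTheory.klDiv ν μ₀) (InformationTheory.klDiv ν μ₁)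

/-- The rate `min {Ch(μ_â, μ_a*), min KL(μ_a, μ_a*)}`, where the inner minimum is over the actions
`a ≠ â` that are less costly than `a*` (and is `⊤` if there are none). -/
noncomputable def severeRate (μ : A → Measure X) (c : A → ℝ) (astar ahat : A) : ℝ≥0∞ :=
  min (chernoff (μ ahat) (μ astar))
    (⨅ (a : A) (_ : c a < c astar ∧ a ≠ ahat), InformationTheory.klDiv (μ a) (μ astar))

end Definitions

/-- `C n` converges to `L` exponentially at rate `ρ`: `ρ` is positive and finite, and
`C n - L = exp (-ρ n + o(n))`. (For finitely many `n` the cost may be infinite.) -/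
def ConvergesAtRate (C : ℕ → EReal) (L : ℝ) (ρ : ℝ≥0∞) : Prop :=
  0 < ρ ∧ ρ ≠ ⊤ ∧ ∃ r : ℕ → ℝ, r =o[atTop] (fun n : ℕ => (n : ℝ)) ∧
    ∀ᶠ n : ℕ in atTop, C n = ((L + Real.exp (-ρ.toReal * n + r n) : ℝ) : EReal)

end MoralHazard

/-! Let `L` be the wage with `u L = u wmin + c astar - c ahat`; it is the first-best cost. Any
scheme can be read as a test: a wage at most some `y < L` rejects `astar`, a higher one accepts.

Lower bound. By strict concavity, `IsUtility.exists_premium` bounds the excess of the expected wage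
over `L` below by a multiple of the utility surplus under `astar` plus a multiple of the rejection
probability under `astar`. Acceptance under `ahat` raises the surplus that incentive compatibility
demands, so the excess dominates the sum of the two error probabilities, which cannot decay faster
than the Chernoff rate. For an intermediate action `a`, the cost saving is smaller than for `ahat`,
so deterrence only requires rejection under `a` to keep a probability bounded away from zero; a
change of measure (`eventually_iidLaw_real_le`) then forces rejection under `astar` with probability
of order `exp (-n KL)`.

Upper bound. Intersecting a Chernoff test against `ahat` with a Stein test against each intermediate
action gives regions with total error `ε = O(exp (-n r))` for any `r` below the rate
(`exists_acceptance_regions`). Paying `L + O(ε)` on acceptance and `wmin` otherwise implements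
`astar` (`exists_binaryCost_le`). Since binary schemes are a subclass, the two bounds squeeze both
costs, and `convergesAtRate_of_bounds` turns bounds at all nearby rates into the asymptotic formula.
-/

namespace MoralHazard


/-! ### Large deviations for i.i.d. tests: Stein's lemma and the Chernoff converse. -/

section LargeDeviations

variable {X : Type*} [MeasurableSpace X]

instance iidLaw.instIsProbabilityMeasure (n : ℕ) (ν : Measure X) [IsProbabilityMeasure ν] :
    IsProbabilityMeasure (iidLaw n ν) := by
  unfold iidLaw; infer_instance

/-- The weak law of large numbers for i.i.d. draws. -/
theorem tendsto_iidLaw_deviation (ν : Measure X) [IsProbabilityMeasure ν] {f : X → ℝ}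
    (hf : Measurable f) (hint : Integrable f ν) {ε : ℝ} (hε : 0 < ε) :
    Tendsto (fun n : ℕ => (iidLaw n ν).real
      {x | n * ε ≤ |(∑ i, f (x i)) - n * ∫ y, f y ∂ν|}) atTop (𝓝 0) := by
  -- All sample sizes live on one infinite product space, where the strong law applies; its first
  -- `n` coordinates have law `iidLaw n ν`.
  set P : Measure (ℕ → X) := Measure.infinitePi fun _ => ν
  have hident : ∀ i : ℕ, ProbabilityTheory.IdentDistrib (fun ω : ℕ → X => f (ω i))
      (fun ω : ℕ → X => f (ω 0)) P P := fun i =>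
    { aemeasurable_fst := (by fun_prop : Measurable fun ω : ℕ → X => f (ω i)).aemeasurable
      aemeasurable_snd := (by fun_prop : Measurable fun ω : ℕ → X => f (ω 0)).aemeasurable
      map_eq := by
        have h : ∀ j : ℕ, P.map (fun ω : ℕ → X => f (ω j)) = ν.map f := fun j => by
          rw [← Measure.infinitePi_map_eval (fun _ : ℕ => ν) j,
            Measure.map_map hf (measurable_pi_apply j)]
          rfl
        rw [h i, h 0] }
  have hmp : MeasurePreserving (fun ω : ℕ → X => ω 0) P ν :=
    measurePreserving_eval_infinitePi (fun _ : ℕ => ν) 0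
  have hint0 : Integrable (fun ω : ℕ → X => f (ω 0)) P := hmp.integrable_comp_of_integrable hint
  have hmean : ∫ ω, f (ω 0) ∂P = ∫ y, f y ∂ν := by
    rw [← hmp.map_eq, integral_map hmp.measurable.aemeasurable hf.aestronglyMeasurable]
  have hindep : Pairwise fun i j => ProbabilityTheory.IndepFun
      (fun ω : ℕ → X => f (ω i)) (fun ω : ℕ → X => f (ω j)) P := fun i j hij =>
    (ProbabilityTheory.iIndepFun_infinitePi (P := fun _ : ℕ => ν) (X := fun _ => f)
      (fun _ => hf)).indepFun hij
  have hae := ProbabilityTheory.strong_law_ae (fun i (ω : ℕ → X) => f (ω i)) hint0 hindep hident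
  have hmeas := tendstoInMeasure_of_tendsto_ae (fun n => by
    exact (by fun_prop : Measurable fun ω : ℕ → X =>
      (n : ℝ)⁻¹ • ∑ i ∈ Finset.range n, f (ω i)).aestronglyMeasurable) hae
  rw [tendstoInMeasure_iff_measureReal_norm] at hmeas
  refine (hmeas ε hε).congr' ?_
  filter_upwards [eventually_gt_atTop 0] with n hn
  have hlaw : iidLaw n ν = P.map (fun ω (i : Fin n) => ω i) := by
    rw [Measure.map_infinitePi_infinitePi_of_inj (P := fun _ : ℕ => ν) Fin.val_injective,
      Measure.infinitePi_eq_pi]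
    rfl
  have hset : MeasurableSet {x : Fin n → X | n * ε ≤ |(∑ i, f (x i)) - n * ∫ y, f y ∂ν|} :=
    measurableSet_le measurable_const (by fun_prop)
  rw [hlaw, map_measureReal_apply (by fun_prop) hset]
  congr 1
  ext ω
  have hn' : (0 : ℝ) < n := by exact_mod_cast hn
  simp only [Set.mem_ofPred_eq, Set.mem_preimage, hmean, Real.norm_eq_abs, smul_eq_mul]
  rw [Finset.sum_range fun i => f (ω i)]
  have : (∑ i : Fin n, f (ω i)) - n * ∫ y, f y ∂ν =
      n * ((n : ℝ)⁻¹ * ∑ i : Fin n, f (ω i) - ∫ y, f y ∂ν) := by field_simp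
  rw [this, abs_mul, abs_of_pos hn', mul_le_mul_iff_right₀ hn']

/-- The exponential Markov inequality for i.i.d. sums. -/
theorem iidLaw_real_sum_ge_le (μ : Measure X) [IsProbabilityMeasure μ] {f : X → ℝ}
    (hint : Integrable (fun x => Real.exp (f x)) μ) (n : ℕ) (s : ℝ) :
    (iidLaw n μ).real {x | s ≤ ∑ i, f (x i)} ≤
      Real.exp (-s) * (∫ x, Real.exp (f x) ∂μ) ^ n := by
  have hprod : Integrable (fun x : Fin n → X => ∏ i, Real.exp (f (x i))) (iidLaw n μ) :=
    Integrable.fintype_prod (f := fun _ x => Real.exp (f x)) (μ := fun _ => μ) fun _ => hint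
  have h := ProbabilityTheory.measure_ge_le_exp_mul_mgf (μ := iidLaw n μ)
    (X := fun x : Fin n → X => ∑ i, f (x i)) s zero_le_one
    (by simpa only [one_mul, Real.exp_sum] using hprod)
  have hmgf : ProbabilityTheory.mgf (fun x : Fin n → X => ∑ i, f (x i)) (iidLaw n μ) 1 =
      (∫ x, Real.exp (f x) ∂μ) ^ n := by
    simp only [ProbabilityTheory.mgf, one_mul, Real.exp_sum]
    rw [iidLaw, integral_fintype_prod_eq_pow (fun x => Real.exp (f x)), Fintype.card_fin]
  simpa only [neg_mul, one_mul, hmgf] using h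

theorem iidLaw_eq_withDensity {ν μ : Measure X} [IsProbabilityMeasure ν] [IsProbabilityMeasure μ]
    (hac : ν ≪ μ) (n : ℕ) :
    iidLaw n ν = (iidLaw n μ).withDensity
      fun x => ENNReal.ofReal (∏ i, (ν.rnDeriv μ (x i)).toReal) := by
  have hint : Integrable (fun x => (ν.rnDeriv μ x).toReal) μ := Measure.integrable_toReal_rnDeriv
  refine Measure.pi_eq fun s hs => ?_
  rw [withDensity_apply _ (MeasurableSet.univ_pi hs), iidLaw, Measure.restrict_pi_pi,
    ← ofReal_integral_eq_lintegral_ofReal, integral_fintype_prod_eq_prod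
      (fun _ x => (ν.rnDeriv μ x).toReal), ENNReal.ofReal_prod_of_nonneg]
  · refine Finset.prod_congr rfl fun i _ => ?_
    rw [Measure.setIntegral_toReal_rnDeriv hac, ofReal_measureReal]
  · exact fun i _ => integral_nonneg fun x => ENNReal.toReal_nonneg
  · exact Integrable.fintype_prod (f := fun _ x => (ν.rnDeriv μ x).toReal)
      (μ := fun i => μ.restrict (s i)) fun i => hint.restrict
  · exact ae_of_all _ fun x => Finset.prod_nonneg fun i _ => ENNReal.toReal_nonneg

/-- Change of measure on a set where the log-likelihood ratio is bounded. -/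
theorem iidLaw_real_le_exp_mul {ν μ : Measure X} [IsProbabilityMeasure ν]
    [IsProbabilityMeasure μ] (hac : ν ≪ μ) {n : ℕ} {s : ℝ} {S : Set (Fin n → X)}
    (hS : MeasurableSet S) (h : ∀ x ∈ S, ∑ i, llr ν μ (x i) ≤ s) :
    (iidLaw n ν).real S ≤ Real.exp s * (iidLaw n μ).real S := by
  have hle : (iidLaw n ν) S ≤ ENNReal.ofReal (Real.exp s) * (iidLaw n μ) S := by
    rw [iidLaw_eq_withDensity hac, withDensity_apply _ hS, ← setLIntegral_const]
    refine setLIntegral_mono measurable_const fun x hx => ENNReal.ofReal_le_ofReal ?_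
    refine le_trans ?_ (Real.exp_le_exp.2 (h x hx))
    rw [Real.exp_sum]
    refine Finset.prod_le_prod (fun i _ => ENNReal.toReal_nonneg) fun i _ => ?_
    -- The convention `log 0 = 0` is harmless here: where the density vanishes the bound reads `0 ≤
    -- 1`.
    exact Real.le_exp_log _
  have := ENNReal.toReal_mono (ENNReal.mul_ne_top ENNReal.ofReal_ne_top (measure_ne_top _ _)) hle
  rwa [ENNReal.toReal_mul, ENNReal.toReal_ofReal (Real.exp_nonneg _)] at this

theorem toReal_klDiv_eq_integral {ν μ : Measure X} [IsProbabilityMeasure ν]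
    [IsProbabilityMeasure μ] (h : InformationTheory.klDiv ν μ ≠ ⊤) :
    (InformationTheory.klDiv ν μ).toReal = ∫ x, llr ν μ x ∂ν :=
  InformationTheory.toReal_klDiv_of_measure_eq (InformationTheory.klDiv_ne_top_iff.1 h).1
    (by simp)

/-- The converse part of Stein's lemma, uniformly over tests. -/
theorem eventually_iidLaw_real_le {ν μ : Measure X} [IsProbabilityMeasure ν]
    [IsProbabilityMeasure μ] {r : ℝ} (hr : InformationTheory.klDiv ν μ < ENNReal.ofReal r)
    {η : ℝ} (hη : 0 < η) :
    ∀ᶠ n : ℕ in atTop, ∀ S : Set (Fin n → X), MeasurableSet S →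
      (iidLaw n ν).real S ≤ Real.exp (n * r) * (iidLaw n μ).real S + η := by
  obtain ⟨hac, hint⟩ := InformationTheory.klDiv_ne_top_iff.1 hr.ne_top
  have hK := toReal_klDiv_eq_integral hr.ne_top
  have hlt : ∫ x, llr ν μ x ∂ν < r := by
    rw [← hK]; exact (ENNReal.lt_ofReal_iff_toReal_lt hr.ne_top).1 hr
  have hlim := tendsto_iidLaw_deviation ν (measurable_llr ν μ) hint (sub_pos.2 hlt)
  filter_upwards [hlim.eventually (gt_mem_nhds hη)] with n hn S hS
  set T : Set (Fin n → X) := {x | ∑ i, llr ν μ (x i) ≤ n * r}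
  have hT : MeasurableSet T := by
    have := measurable_llr ν μ
    exact measurableSet_le (by fun_prop) measurable_const
  have h1 := iidLaw_real_le_exp_mul hac (hS.inter hT) (s := n * r) fun x hx => hx.2
  have h2 : (iidLaw n ν).real Tᶜ ≤ η := by
    refine (measureReal_mono fun x hx => ?_).trans hn.le
    simp only [T, Set.mem_compl_iff, Set.mem_ofPred_eq, not_le] at hx ⊢
    refine le_trans ?_ (le_abs_self _)
    linarith
  calc (iidLaw n ν).real S ≤ (iidLaw n ν).real (S ∩ T) + (iidLaw n ν).real Tᶜ := by
        refine (measureReal_mono fun x hx => ?_).trans (measureReal_union_le _ _)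
        by_cases hxT : x ∈ T
        · exact Or.inl ⟨hx, hxT⟩
        · exact Or.inr hxT
    _ ≤ Real.exp (n * r) * (iidLaw n μ).real S + η := by
        refine add_le_add (h1.trans ?_) h2
        exact mul_le_mul_of_nonneg_left (measureReal_mono Set.inter_subset_left)
          (Real.exp_nonneg _)

/-- The sum of the error probabilities of a test decays at most at the Chernoff rate. -/
theorem eventually_le_errors_of_chernoff_lt {μ₀ μ₁ : Measure X} [IsProbabilityMeasure μ₀]
    [IsProbabilityMeasure μ₁] {r : ℝ} (hr : chernoff μ₀ μ₁ < ENNReal.ofReal r) :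
    ∀ᶠ n : ℕ in atTop, ∀ S : Set (Fin n → X), MeasurableSet S →
      Real.exp (-(n * r)) / 2 ≤ (iidLaw n μ₀).real S + (iidLaw n μ₁).real Sᶜ := by
  obtain ⟨ν, hν⟩ := iInf_lt_iff.1 hr
  obtain ⟨hprob, hν⟩ := iInf_lt_iff.1 hν
  rw [max_lt_iff] at hν
  filter_upwards [eventually_iidLaw_real_le hν.1 (by norm_num : (0 : ℝ) < 1 / 4),
    eventually_iidLaw_real_le hν.2 (by norm_num : (0 : ℝ) < 1 / 4)] with n h0 h1 S hS
  -- The two `ν`-probabilities sum to one and the two slacks of `1 / 4` to one half, leaving `1 / 2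
  -- ≤ exp (n r)` times the error sum.
  have h := add_le_add (h0 S hS) (h1 Sᶜ hS.compl)
  rw [measureReal_add_measureReal_compl hS, probReal_univ] at h
  have hexp : Real.exp (-(n * r)) * Real.exp (n * r) = 1 := by rw [← Real.exp_add]; simp
  have hpos := Real.exp_pos (-(n * r))
  nlinarith

/-- The direct part of Stein's lemma. -/
theorem exists_stein_test {ν μ : Measure X} [IsProbabilityMeasure ν] [IsProbabilityMeasure μ]
    (hμν : μ ≪ ν) (hfin : InformationTheory.klDiv ν μ ≠ ⊤) {r : ℝ}
    (hr : ENNReal.ofReal r < InformationTheory.klDiv ν μ) :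
    ∃ S : ∀ n : ℕ, Set (Fin n → X), (∀ n, MeasurableSet (S n)) ∧
      (∀ n, (iidLaw n μ).real (S n)ᶜ ≤ Real.exp (-(n * r))) ∧
      Tendsto (fun n => (iidLaw n ν).real (S n)) atTop (𝓝 0) := by
  obtain ⟨hac, hint⟩ := InformationTheory.klDiv_ne_top_iff.1 hfin
  have hlt : r < ∫ x, llr ν μ x ∂ν := by
    rw [← toReal_klDiv_eq_integral hfin]
    by_contra! h
    exact (ENNReal.le_ofReal_iff_toReal_le hfin (ENNReal.toReal_nonneg.trans h)).2 h |>.not_gt hr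
  have hm := measurable_llr ν μ
  refine ⟨fun n => {x | n * r ≤ ∑ i, llr ν μ (x i)}ᶜ, fun n =>
    (measurableSet_le measurable_const (by fun_prop)).compl, fun n => ?_, ?_⟩
  -- The exponential moment of the log-likelihood ratio under `μ` is the mass of `ν`, which is one,
  -- so Markov's inequality gives exactly `exp (-n r)`.
  · have hexp := exp_llr_of_ac' ν μ hμν
    have hint' : Integrable (fun x => Real.exp (llr ν μ x)) μ :=
      Measure.integrable_toReal_rnDeriv.congr hexp.symm
    have h := iidLaw_real_sum_ge_le μ hint' n (n * r)
    rw [integral_congr_ae hexp, Measure.integral_toReal_rnDeriv hac, probReal_univ, one_pow,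
      mul_one] at h
    rwa [compl_compl]
  · refine squeeze_zero (fun n => measureReal_nonneg) (fun n => measureReal_mono fun x hx => ?_)
      (tendsto_iidLaw_deviation ν hm hint (sub_pos.2 hlt))
    simp only [Set.mem_compl_iff, Set.mem_ofPred_eq, not_le] at hx ⊢
    refine le_trans ?_ (neg_le_abs _)
    linarith

end LargeDeviations


/-! ### The Chernoff distance: attainability by a likelihood ratio test, and positivity. -/

section Chernoff

variable {X : Type*} [MeasurableSpace X]

/-- Since `log x ≤ x - 1`, the integrand `x log x + 1 - x` is at most `x ^ 2 + 1`. -/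
theorem klDiv_ne_top_of_lintegral_rnDeriv_sq {ν μ : Measure X} [IsProbabilityMeasure ν]
    [IsProbabilityMeasure μ] (hac : ν ≪ μ)
    (hsq : ∫⁻ x, (ν.rnDeriv μ x) ^ (2 : ℝ) ∂μ < ⊤) : InformationTheory.klDiv ν μ ≠ ⊤ := by
  rw [InformationTheory.klDiv_eq_lintegral_klFun_of_ac hac]
  refine ne_top_of_le_ne_top (b := ∫⁻ x, ((ν.rnDeriv μ x) ^ (2 : ℝ) + 1) ∂μ) ?_ ?_
  · rw [lintegral_add_right _ measurable_const]
    simpa using hsq.ne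
  · refine lintegral_mono_ae ?_
    filter_upwards [Measure.rnDeriv_ne_top ν μ] with x hx
    have hnn : 0 ≤ (ν.rnDeriv μ x).toReal := ENNReal.toReal_nonneg
    have hle : InformationTheory.klFun (ν.rnDeriv μ x).toReal ≤
        (ν.rnDeriv μ x).toReal ^ (2 : ℝ) + 1 := by
      rw [InformationTheory.klFun, Real.rpow_two]
      rcases hnn.eq_or_lt with h | h
      · simp [← h]
      · nlinarith [Real.log_le_sub_one_of_pos h]
    refine (ENNReal.ofReal_le_ofReal hle).trans ?_
    rw [ENNReal.ofReal_add (by positivity) zero_le_one, ← ENNReal.ofReal_rpow_of_nonneg hnn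
      (by norm_num), ENNReal.ofReal_toReal hx, ENNReal.ofReal_one]

theorem integrable_rnDeriv_of_lintegral_rnDeriv_sq {ν μ : Measure X} [IsProbabilityMeasure ν]
    [IsProbabilityMeasure μ] (hac : ν ≪ μ)
    (hsq : ∫⁻ x, (ν.rnDeriv μ x) ^ (2 : ℝ) ∂μ < ⊤) :
    Integrable (fun x => (ν.rnDeriv μ x).toReal) ν := by
  refine integrable_toReal_of_lintegral_ne_top (Measure.measurable_rnDeriv ν μ).aemeasurable ?_
  rw [← lintegral_rnDeriv_mul hac (Measure.measurable_rnDeriv ν μ).aemeasurable]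
  convert hsq.ne using 3 with x
  rw [ENNReal.rpow_two, sq]

/-- Hellinger argument: with `f` the square root of the likelihood ratio, `∫ (f - 1) ^ 2 = 2 - 2 ∫
f`, and this vanishes only if the ratio is one almost everywhere. -/
theorem exists_mgf_llr_lt_one {μ₀ μ₁ : Measure X} [IsProbabilityMeasure μ₀]
    [IsProbabilityMeasure μ₁] (hne : μ₀ ≠ μ₁) (hac : μ₁ ≪ μ₀) (hac' : μ₀ ≪ μ₁)
    (hint : Integrable (fun x => Real.exp (1 / 2 * llr μ₁ μ₀ x)) μ₀) :
    ProbabilityTheory.mgf (llr μ₁ μ₀) μ₀ (1 / 2) < 1 := by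
  set f : X → ℝ := fun x => Real.exp (1 / 2 * llr μ₁ μ₀ x)
  have hff : ∀ x, f x ^ 2 = Real.exp (llr μ₁ μ₀ x) := fun x => by
    rw [sq, ← Real.exp_add]; ring_nf
  have hexp := exp_llr_of_ac' μ₁ μ₀ hac'
  have hsq : Integrable (fun x => f x ^ 2) μ₀ := by
    simp only [hff]; exact Measure.integrable_toReal_rnDeriv.congr hexp.symm
  have hone : ∫ x, f x ^ 2 ∂μ₀ = 1 := by
    simp only [hff]
    rw [integral_congr_ae hexp, Measure.integral_toReal_rnDeriv hac, probReal_univ]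
  have hint2 : Integrable (fun x => (f x - 1) ^ 2) μ₀ := by
    have : (fun x => (f x - 1) ^ 2) = fun x => f x ^ 2 - 2 * f x + 1 := by ext x; ring
    rw [this]; exact (hsq.sub (hint.const_mul 2)).add (integrable_const 1)
  have hval : ∫ x, (f x - 1) ^ 2 ∂μ₀ = 2 - 2 * ∫ x, f x ∂μ₀ := by
    have : (fun x => (f x - 1) ^ 2) = fun x => (f x ^ 2 - 2 * f x) + 1 := by ext x; ring
    rw [this]
    erw [integral_add (hsq.sub (hint.const_mul 2)) (integrable_const 1)]
    simp only [Pi.sub_apply]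
    rw [integral_sub hsq (hint.const_mul 2), hone, integral_const_mul]
    simp; ring
  have hnn : 0 ≤ ∫ x, (f x - 1) ^ 2 ∂μ₀ := integral_nonneg fun x => sq_nonneg _
  have hpos : 0 < ∫ x, (f x - 1) ^ 2 ∂μ₀ := by
    refine lt_of_le_of_ne hnn fun h0 => hne ?_
    have h1 := (integral_eq_zero_iff_of_nonneg (fun x => sq_nonneg (f x - 1)) hint2).1 h0.symm
    refine ((Measure.rnDeriv_eq_one_iff_eq hac).1 ?_).symm
    filter_upwards [h1, hexp, Measure.rnDeriv_ne_top μ₁ μ₀] with x hx hx' hx''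
    have hfx : f x = 1 := by
      have : (f x - 1) ^ 2 = 0 := hx
      nlinarith [pow_eq_zero_iff (two_ne_zero) |>.1 this]
    rw [← hff, hfx, one_pow] at hx'
    rw [← ENNReal.ofReal_toReal hx'', ← hx']; simp
  show ∫ x, f x ∂μ₀ < 1
  linarith

/-- Integrating the affine expression kills the centred part. Exponential tilts have log-likelihood
ratios of this form. -/
theorem klDiv_eq_ofReal_of_llr_eq {ν μ : Measure X} [IsProbabilityMeasure ν]
    [IsProbabilityMeasure μ] (hac : ν ≪ μ) {f : X → ℝ} (hf : Integrable f ν)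
    (hmean : ∫ x, f x ∂ν = 0) {a b : ℝ} (h : llr ν μ =ᵐ[ν] fun x => a * f x + b) :
    InformationTheory.klDiv ν μ = ENNReal.ofReal b := by
  have hint : Integrable (llr ν μ) ν :=
    ((hf.const_mul a).add (integrable_const b)).congr h.symm
  have hne := InformationTheory.klDiv_ne_top hac hint
  rw [← ENNReal.ofReal_toReal hne, toReal_klDiv_eq_integral hne, integral_congr_ae h,
    integral_add (hf.const_mul a) (integrable_const b), integral_const_mul, hmean]
  simp

/-- A likelihood ratio test both of whose error probabilities decay at least at the Chernoff
rate. -/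
theorem exists_chernoff_test {μ₀ μ₁ : Measure X} [IsProbabilityMeasure μ₀]
    [IsProbabilityMeasure μ₁] (hne : μ₀ ≠ μ₁) (hac : μ₁ ≪ μ₀) (hac' : μ₀ ≪ μ₁)
    (hsq : ∫⁻ x, (μ₁.rnDeriv μ₀ x) ^ (2 : ℝ) ∂μ₀ < ⊤)
    (hsq' : ∫⁻ x, (μ₀.rnDeriv μ₁ x) ^ (2 : ℝ) ∂μ₁ < ⊤) :
    ∃ R : ℝ, 0 < R ∧ chernoff μ₀ μ₁ ≤ ENNReal.ofReal R ∧
      ∃ S : ∀ n : ℕ, Set (Fin n → X), ∀ n, MeasurableSet (S n) ∧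
        (iidLaw n μ₀).real (S n) ≤ Real.exp (-(n * R)) ∧
        (iidLaw n μ₁).real (S n)ᶜ ≤ Real.exp (-(n * R)) := by
  set l := llr μ₁ μ₀
  have hl : Measurable l := measurable_llr μ₁ μ₀
  have hexp : (fun x => Real.exp (l x)) =ᵐ[μ₀] fun x => (μ₁.rnDeriv μ₀ x).toReal :=
    exp_llr_of_ac' μ₁ μ₀ hac'
  have h2 : (2 : ℝ) ∈ ProbabilityTheory.integrableExpSet l μ₀ := by
    have hi : Integrable (fun x => ((μ₁.rnDeriv μ₀ x) ^ (2 : ℝ)).toReal) μ₀ :=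
      integrable_toReal_of_lintegral_ne_top
        ((Measure.measurable_rnDeriv μ₁ μ₀).pow_const 2).aemeasurable hsq.ne
    refine hi.congr ?_
    filter_upwards [hexp] with x hx
    rw [← ENNReal.toReal_rpow, ← hx, Real.rpow_two, sq, ← Real.exp_add]
    ring_nf
  have hneg : (-1 : ℝ) ∈ ProbabilityTheory.integrableExpSet l μ₀ := by
    refine (integrable_rnDeriv_of_lintegral_rnDeriv_sq hac' hsq').congr ?_
    filter_upwards [exp_neg_llr' (μ := μ₁) (ν := μ₀) hac'] with x hx
    rw [neg_one_mul, ← hx]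
  -- Moments at `-1` and `2` place the closed unit interval in the interior, so `M` is
  -- differentiable even at its endpoints.
  have hsub : Set.Icc (0 : ℝ) 1 ⊆ interior (ProbabilityTheory.integrableExpSet l μ₀) := by
    have h : Set.Icc (-1 : ℝ) 2 ⊆ ProbabilityTheory.integrableExpSet l μ₀ :=
      ProbabilityTheory.convex_integrableExpSet.ordConnected.out hneg h2
    refine fun t ht => interior_mono h ?_
    rw [interior_Icc]
    exact ⟨by linarith [ht.1], by linarith [ht.2]⟩
  set M := ProbabilityTheory.mgf l μ₀
  have hM0 : M 0 = 1 := ProbabilityTheory.mgf_zero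
  have hM1 : M 1 = 1 := by
    simp only [M, ProbabilityTheory.mgf, one_mul]
    rw [integral_congr_ae hexp, Measure.integral_toReal_rnDeriv hac, probReal_univ]
  obtain ⟨t, ht, hmin⟩ := isCompact_Icc.exists_isMinOn (Set.nonempty_Icc.2 zero_le_one)
    (ProbabilityTheory.continuousOn_mgf.mono hsub : ContinuousOn M (Set.Icc 0 1))
  have hmem : (1 / 2 : ℝ) ∈ Set.Icc (0 : ℝ) 1 := ⟨by norm_num, by norm_num⟩
  have hhalf : M (1 / 2) < 1 := exists_mgf_llr_lt_one hne hac hac'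
    (interior_subset (s := ProbabilityTheory.integrableExpSet l μ₀) (hsub hmem))
  have hMt : M t < 1 := lt_of_le_of_lt (hmin hmem) hhalf
  -- As `M 0 = M 1 = 1` exceeds the minimum, the minimiser is interior and `M` has zero derivative
  -- there.
  have ht0 : 0 < t := lt_of_le_of_ne ht.1 fun h => by rw [← h, hM0] at hMt; exact lt_irrefl _ hMt
  have ht1 : t < 1 := lt_of_le_of_ne ht.2 fun h => by rw [h, hM1] at hMt; exact lt_irrefl _ hMt
  have htint := hsub ht
  have hti : Integrable (fun x => Real.exp (t * l x)) μ₀ :=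
    interior_subset (s := ProbabilityTheory.integrableExpSet l μ₀) htint
  have hMpos : 0 < M t := ProbabilityTheory.mgf_pos hti
  have hderiv : deriv M t = 0 := (hmin.isLocalMin (Icc_mem_nhds ht0 ht1)).deriv_eq_zero
  have hmeas := hl.aemeasurable (μ := μ₁)
  -- Under this tilt `l` has mean `M' t / M t = 0`, so `ν` has the same divergence `-log (M t)` from
  -- `μ₀` and from `μ₁`: it is the witness bounding the Chernoff distance.
  set ν := μ₀.tilted (fun x => t * l x)
  have hνprob : IsProbabilityMeasure ν := isProbabilityMeasure_tilted hti
  have hν0 : ν ≪ μ₀ := tilted_absolutelyContinuous _ _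
  have hlν : Integrable l ν := by
    have := ProbabilityTheory.memLp_tilted_mul htint 1
    exact memLp_one_iff_integrable.1 (by simpa using this)
  have hlmean : ∫ x, l x ∂ν = 0 := by
    have := ProbabilityTheory.integral_tilted_mul_self htint
    rw [ProbabilityTheory.deriv_cgf htint, ← ProbabilityTheory.deriv_mgf htint] at this
    rw [this, hderiv, zero_div]
  have hk0 : InformationTheory.klDiv ν μ₀ = ENNReal.ofReal (-Real.log (M t)) := by
    refine klDiv_eq_ofReal_of_llr_eq hν0 hlν hlmean (a := t) (hν0.ae_le ?_)
    filter_upwards [llr_tilted_left Measure.AbsolutelyContinuous.rfl hti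
      (hl.const_mul t).aemeasurable, llr_self μ₀] with x hx hx'
    rw [hx, hx']
    simp only [Pi.zero_apply, add_zero, sub_eq_add_neg]
    rfl
  have hk1 : InformationTheory.klDiv ν μ₁ = ENNReal.ofReal (-Real.log (M t)) := by
    refine klDiv_eq_ofReal_of_llr_eq (hν0.trans hac') hlν hlmean (a := t - 1) (hν0.ae_le ?_)
    filter_upwards [llr_tilted_left hac' hti (hl.const_mul t).aemeasurable, neg_llr hac']
      with x hx hx'
    have : llr μ₀ μ₁ x = - l x := by
      rw [← neg_eq_iff_eq_neg, ← Pi.neg_apply, hx']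
    rw [hx, this]
    show t * l x - Real.log (M t) + -l x = _
    ring
  refine ⟨-Real.log (M t), neg_pos.2 (Real.log_neg hMpos hMt), ?_, ?_⟩
  · refine (iInf₂_le ν hνprob).trans ?_
    rw [hk0, hk1, max_self]
  have hpow : ∀ n : ℕ, Real.exp (-(n * -Real.log (M t))) = M t ^ n := fun n => by
    rw [mul_neg, neg_neg, mul_comm, Real.exp_mul, Real.exp_log hMpos, Real.rpow_natCast]
  have hS : ∀ n : ℕ, MeasurableSet {x : Fin n → X | 0 ≤ ∑ i, l (x i)} := fun n =>
    measurableSet_le measurable_const (by fun_prop)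
  refine ⟨fun n => {x | 0 ≤ ∑ i, l (x i)}, fun n => ⟨hS n, ?_, ?_⟩⟩
  · have h := iidLaw_real_sum_ge_le μ₀ hti n 0
    rw [neg_zero, Real.exp_zero, one_mul] at h
    rw [hpow]
    refine (measureReal_mono fun x hx => ?_).trans h
    simp only [Set.mem_ofPred_eq] at hx ⊢
    rw [← Finset.mul_sum]
    exact mul_nonneg ht0.le hx
  -- The moment of `l` at `t - 1` under `μ₁` equals its moment at `t` under `μ₀`, so `M t` controls
  -- both errors.
  · have hae : (fun x => (μ₁.rnDeriv μ₀ x).toReal • Real.exp ((t - 1) * l x)) =ᵐ[μ₀]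
        fun x => Real.exp (t * l x) := by
      filter_upwards [hexp] with x hx
      rw [← hx, smul_eq_mul, ← Real.exp_add]; ring_nf
    have hint : Integrable (fun x => Real.exp ((t - 1) * l x)) μ₁ :=
      (integrable_rnDeriv_smul_iff hac).1 (hti.congr hae.symm)
    have h := iidLaw_real_sum_ge_le μ₁ hint n 0
    rw [neg_zero, Real.exp_zero, one_mul, ← integral_rnDeriv_smul hac, integral_congr_ae hae] at h
    rw [hpow]
    refine (measureReal_mono fun x hx => ?_).trans h
    simp only [Set.mem_compl_iff, Set.mem_ofPred_eq, not_le] at hx ⊢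
    rw [← Finset.mul_sum]
    nlinarith

/-- At distance zero, the converse at rate `R / 2` would force an error sum of at least `exp (-n R /
2) / 2`, whereas the likelihood ratio test achieves `2 exp (-n R)`. -/
theorem chernoff_pos {μ₀ μ₁ : Measure X} [IsProbabilityMeasure μ₀]
    [IsProbabilityMeasure μ₁] (hne : μ₀ ≠ μ₁) (hac : μ₁ ≪ μ₀) (hac' : μ₀ ≪ μ₁)
    (hsq : ∫⁻ x, (μ₁.rnDeriv μ₀ x) ^ (2 : ℝ) ∂μ₀ < ⊤)
    (hsq' : ∫⁻ x, (μ₀.rnDeriv μ₁ x) ^ (2 : ℝ) ∂μ₁ < ⊤) : 0 < chernoff μ₀ μ₁ := by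
  obtain ⟨R, hR, -, S, hS⟩ := exists_chernoff_test hne hac hac' hsq hsq'
  by_contra! h0
  have hlt : chernoff μ₀ μ₁ < ENNReal.ofReal (R / 2) :=
    h0.trans_lt (ENNReal.ofReal_pos.2 (by linarith))
  have hlim : Tendsto (fun n : ℕ => Real.exp (-(n * (R / 2)))) atTop (𝓝 0) := by
    refine Real.tendsto_exp_neg_atTop_nhds_zero.comp
      (tendsto_natCast_atTop_atTop.atTop_mul_const (by linarith))
  obtain ⟨n, hn, hn'⟩ := ((eventually_le_errors_of_chernoff_lt hlt).and
    (hlim.eventually (gt_mem_nhds (by norm_num : (0 : ℝ) < 1 / 4)))).exists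
  have h := hn (S n) (hS n).1
  have h1 := (hS n).2.1
  have h2 := (hS n).2.2
  have hsplit : Real.exp (-(n * R)) = Real.exp (-(n * (R / 2))) * Real.exp (-(n * (R / 2))) := by
    rw [← Real.exp_add]; ring_nf
  rw [hsplit] at h1 h2
  have hpos := Real.exp_pos (-(n * (R / 2)))
  nlinarith

end Chernoff


/-! ### Concavity estimates for the utility, and the first-best cost. -/

section Utility

variable {u : ℝ → ℝ} {wmin : ℝ}

theorem IsUtility.continuousOn (hu : IsUtility u wmin) : ContinuousOn u (Set.Ici wmin) :=
  hu.contDiffOn.continuousOn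

theorem IsUtility.strictMonoOn (hu : IsUtility u wmin) : StrictMonoOn u (Set.Ici wmin) := by
  refine strictMonoOn_of_deriv_pos (convex_Ici wmin) hu.continuousOn fun x hx => ?_
  have hpos := hu.deriv_pos x (interior_subset hx)
  rwa [derivWithin_of_mem_nhds (mem_interior_iff_mem_nhds.1 hx)] at hpos

theorem IsUtility.strictConcaveOn (hu : IsUtility u wmin) :
    StrictConcaveOn ℝ (Set.Ici wmin) u := by
  refine strictConcaveOn_of_deriv2_neg (convex_Ici wmin) hu.continuousOn fun x hx => ?_
  have hneg := hu.deriv2_neg x (interior_subset hx)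
  have hset : Set.Ici wmin =ᶠ[𝓝 x] Set.univ :=
    eventuallyEq_univ.2 (mem_interior_iff_mem_nhds.1 hx)
  rwa [iteratedDerivWithin, iteratedFDerivWithin_congr_set hset, ← iteratedDerivWithin,
    iteratedDerivWithin_univ, iteratedDeriv_eq_iterate] at hneg

theorem IsUtility.differentiableOn (hu : IsUtility u wmin) :
    DifferentiableOn ℝ u (Set.Ici wmin) := hu.contDiffOn.differentiableOn (by norm_num)

theorem IsUtility.exists_eq (hu : IsUtility u wmin) {b v : ℝ} (hb : wmin ≤ b)
    (hv : u wmin ≤ v) (hvb : v < u b) : ∃ y, wmin ≤ y ∧ y < b ∧ u y = v := by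
  obtain ⟨y, hy, rfl⟩ := intermediate_value_Icc hb
    (hu.continuousOn.mono Set.Icc_subset_Ici_self) ⟨hv, hvb.le⟩
  exact ⟨y, hy.1, (hu.strictMonoOn.lt_iff_lt hy.1 hb).1 hvb, rfl⟩

theorem IsUtility.invUtility_eq (hu : IsUtility u wmin) {y : ℝ} (hy : wmin ≤ y) :
    invUtility u wmin (u y) = y :=
  hu.strictMonoOn.injOn.leftInvOn_invFunOn hy

/-- The supporting line of `u` at `L` lies above `u`, with a uniform gap on `[wmin, y]`. -/
theorem IsUtility.exists_tangent_gap (hu : IsUtility u wmin) {y L : ℝ} (hy : wmin ≤ y)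
    (hyL : y < L) : ∃ p κ : ℝ, 0 < p ∧ 0 < κ ∧
      (∀ w, wmin ≤ w → (u w - u L) / p ≤ w - L) ∧
      ∀ w, wmin ≤ w → w ≤ y → κ + (u w - u L) / p ≤ w - L := by
  have hL : L ∈ Set.Ici wmin := hy.trans hyL.le
  have hdiff := hu.differentiableOn L hL
  have hconc := hu.strictConcaveOn
  set p := derivWithin u (Set.Ici wmin) L
  have hp : 0 < p := hu.deriv_pos L hL
  have hleft : ∀ w, wmin ≤ w → w < L → p * (L - w) < u L - u w := fun w hw hwL => by
    have h := hconc.derivWithin_lt_slope hw hL hwL hdiff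
    rwa [slope_def_field, lt_div_iff₀ (sub_pos.2 hwL)] at h
  have hκ : 0 < (u L - u y) / p - (L - y) := by
    rw [sub_pos, lt_div_iff₀ hp, mul_comm]
    exact hleft y hy hyL
  refine ⟨p, (u L - u y) / p - (L - y), hp, hκ, fun w hw => ?_, fun w hw hwy => ?_⟩
  · rw [div_le_iff₀ hp]
    rcases lt_trichotomy w L with h | rfl | h
    · linarith [hleft w hw h]
    · simp
    · have h' := hconc.slope_lt_derivWithin hL hw h hdiff
      rw [slope_def_field, div_lt_iff₀ (sub_pos.2 h)] at h'
      linarith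
  -- Chord slopes decrease: the slope on `[w, y]` exceeds that on `[y, L]`, which exceeds `p`. Hence
  -- the gap is smallest at `y`.
  · have hwy' : p * (y - w) ≤ u y - u w := by
      rcases hwy.eq_or_lt with rfl | h
      · simp
      · have h1 := hconc.slope_anti_adjacent hw hL h hyL
        have h2 := (lt_div_iff₀ (sub_pos.2 hyL)).2 (hleft y hy hyL)
        exact ((lt_div_iff₀ (sub_pos.2 h)).1 (h2.trans h1)).le
    have h3 : y - w ≤ (u y - u w) / p := by rw [le_div_iff₀ hp]; linarith
    have h4 : (u L - u y) / p + (u w - u L) / p = - ((u y - u w) / p) := by ring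
    linarith

theorem IsUtility.le_of_mem_chord (hu : IsUtility u wmin) {L b w : ℝ} (hL : wmin ≤ L)
    (hLb : L < b) (hw : L ≤ w) (hwb : w ≤ b) :
    u L + (u b - u L) / (b - L) * (w - L) ≤ u w := by
  have hbL : 0 < b - L := sub_pos.2 hLb
  have h := hu.strictConcaveOn.concaveOn.2 hL (hL.trans hLb.le : b ∈ Set.Ici wmin)
    (div_nonneg (sub_nonneg.2 hwb) hbL.le) (div_nonneg (sub_nonneg.2 hw) hbL.le)
    (by field_simp; ring)
  simp only [smul_eq_mul] at h
  have h1 : (b - w) / (b - L) * L + (w - L) / (b - L) * b = w := by field_simp; ring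
  rw [h1] at h
  refine le_trans (le_of_eq ?_) h
  field_simp
  ring

/-- The expected wage exceeds the certain wage `L` by at least the value of the expected utility
surplus plus a premium for utilities that are too low. -/
theorem IsUtility.exists_premium (hu : IsUtility u wmin) {y L : ℝ} (hy : wmin ≤ y)
    (hyL : y < L) : ∃ p κ : ℝ, 0 < p ∧ 0 < κ ∧
      ∀ {Ω : Type*} [MeasurableSpace Ω] (P : Measure Ω) [IsProbabilityMeasure P] (w : Ω → ℝ),
        Measurable w → (∀ x, wmin ≤ w x) → Integrable w P → Integrable (fun x => u (w x)) P →
        κ * P.real {x | w x ≤ y} + ((∫ x, u (w x) ∂P) - u L) / p ≤ (∫ x, w x ∂P) - L := by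
  obtain ⟨p, κ, hp, hκ, h1, h2⟩ := hu.exists_tangent_gap hy hyL
  refine ⟨p, κ, hp, hκ, fun P _ w hw hle hint hintu => ?_⟩
  have hB : MeasurableSet {x | w x ≤ y} := measurableSet_le hw measurable_const
  have hi1 : Integrable ({x | w x ≤ y}.indicator fun _ => κ) P :=
    (integrable_const κ).indicator hB
  have hi2 : Integrable (fun x => (u (w x) - u L) / p) P :=
    (hintu.sub (integrable_const _)).div_const p
  have h := integral_mono (hi1.add hi2) (hint.sub (integrable_const L)) fun x => by
    simp only [Pi.add_apply, Pi.sub_apply]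
    by_cases hx : w x ≤ y
    · rw [Set.indicator_of_mem (by exact hx)]
      exact h2 _ (hle x) hx
    · rw [Set.indicator_of_notMem (by exact hx), zero_add]
      exact h1 _ (hle x)
  rw [integral_add' hi1 hi2, integral_sub' hint (integrable_const L), integral_indicator_const _ hB,
    integral_div, integral_sub hintu (integrable_const _)] at h
  simpa [mul_comm] using h

/-- The binding deviation is to `ahat` at the lowest wage. Participation is then automatic, because
`c ahat ≤ u wmin`. -/
theorem IsUtility.firstBestCost_eq (hu : IsUtility u wmin) {A : Type*} {c : A → ℝ}
    {astar ahat : A} (hne : ahat ≠ astar) (hhat : ∀ a, c ahat ≤ c a) (hsev : c ahat ≤ u wmin)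
    {L : ℝ} (hL : wmin ≤ L) (huL : u L = u wmin + c astar - c ahat) :
    firstBestCost u wmin c astar = (L : EReal) := by
  classical
  have hmono := hu.strictMonoOn
  refine le_antisymm ?_ (le_iInf₂ fun w hw => ?_)
  · refine (iInf₂_le (Function.update (fun _ => wmin) astar L) ⟨fun a => ?_, fun a => ?_, ?_⟩).trans
      (by simp)
    · by_cases h : a = astar
      · subst h; simpa using hL
      · simp [h]
    · by_cases h : a = astar
      · subst h; simp
      · simp only [Function.update_self, Function.update_of_ne h, huL]
        linarith [hhat a]
    · simp only [Function.update_self, huL]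
      linarith
  · obtain ⟨h1, h2, -⟩ := hw
    refine EReal.coe_le_coe_iff.2 ((hmono.le_iff_le hL (h1 astar)).1 ?_)
    have := (hmono.le_iff_le Set.self_mem_Ici (h1 ahat)).2 (h1 ahat)
    linarith [h2 ahat]

end Utility

/-- Exponential bounds at all rates on either side of `ρ` imply convergence at rate `ρ`. -/
theorem convergesAtRate_of_bounds {C : ℕ → EReal} {L : ℝ} {ρ : ℝ≥0∞} (hρ : 0 < ρ) (hρ' : ρ ≠ ⊤)
    (hup : ∀ r : ℝ, 0 < r → ENNReal.ofReal r < ρ →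
      ∃ K : ℝ, ∀ᶠ n : ℕ in atTop, C n ≤ ((L + K * Real.exp (-(n * r)) : ℝ) : EReal))
    (hlow : ∀ r : ℝ, ρ < ENNReal.ofReal r → ∃ K : ℝ, 0 < K ∧
      ∀ᶠ n : ℕ in atTop, ((L + K * Real.exp (-(n * r)) : ℝ) : EReal) ≤ C n) :
    ConvergesAtRate C L ρ := by
  set s := ρ.toReal
  have hs : 0 < s := ENNReal.toReal_pos hρ.ne' hρ'
  have hρs : ρ = ENNReal.ofReal s := (ENNReal.ofReal_toReal hρ').symm
  have key : ∀ c : ℝ, 0 < c → ∀ᶠ n : ℕ in atTop, ∃ x : ℝ, C n = ((L + x : ℝ) : EReal) ∧ 0 < x ∧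
      |Real.log x + s * n| ≤ c * n := by
    intro c hc
    -- The upper bound is available only at positive rates, so `s - c / 2` is replaced by `s / 2`
    -- when `c` is large.
    have hr2 : 0 < max (s - c / 2) (s / 2) := lt_max_of_lt_right (by linarith)
    obtain ⟨K₁, hK₁, h1⟩ := hlow (s + c / 2)
      (by rw [hρs]; exact (ENNReal.ofReal_lt_ofReal_iff (by linarith)).2 (by linarith))
    obtain ⟨K₂, h2⟩ := hup (max (s - c / 2) (s / 2)) hr2
      (by rw [hρs]; exact (ENNReal.ofReal_lt_ofReal_iff hs).2
            (max_lt (by linarith) (by linarith)))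
    have hlarge : ∀ᶠ n : ℕ in atTop,
        max (-Real.log K₁) (Real.log (max K₂ 1)) ≤ n * (c / 2) :=
      (tendsto_natCast_atTop_atTop.atTop_mul_const (by linarith)).eventually_ge_atTop _
    filter_upwards [h1, h2, hlarge] with n h1 h2 hn
    have htop : C n ≠ ⊤ := fun h => by rw [h] at h2; exact absurd h2 (by simp [-EReal.coe_add])
    have hbot : C n ≠ ⊥ := fun h => by rw [h] at h1; exact absurd h1 (by simp [-EReal.coe_add])
    rw [← EReal.coe_toReal htop hbot, EReal.coe_le_coe_iff] at h1 h2
    set y := (C n).toReal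
    have hx : 0 < y - L := by
      have := mul_pos hK₁ (Real.exp_pos (-(n * (s + c / 2))))
      linarith
    refine ⟨y - L, ?_, hx, ?_⟩
    · rw [add_sub_cancel, EReal.coe_toReal htop hbot]
    -- `K₂` carries no sign information; enlarging it to at least one allows taking logarithms.
    · have hK2 : (0 : ℝ) < max K₂ 1 := lt_max_of_lt_right one_pos
      have hl1 : Real.log K₁ - n * (s + c / 2) ≤ Real.log (y - L) := by
        have := Real.log_le_log (mul_pos hK₁ (Real.exp_pos _))
          (by linarith : K₁ * Real.exp (-(n * (s + c / 2))) ≤ y - L)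
        rwa [Real.log_mul hK₁.ne' (Real.exp_pos _).ne', Real.log_exp] at this
      have hl2 : Real.log (y - L) ≤
          Real.log (max K₂ 1) - n * max (s - c / 2) (s / 2) := by
        have := Real.log_le_log hx ((by linarith : y - L ≤ _).trans
          (mul_le_mul_of_nonneg_right (le_max_left K₂ 1) (Real.exp_nonneg _)))
        rwa [Real.log_mul hK2.ne' (Real.exp_pos _).ne', Real.log_exp] at this
      have hn1 := (le_max_left _ _).trans hn
      have hn2 := (le_max_right _ _).trans hn
      have hm : (n : ℝ) * (s - c / 2) ≤ n * max (s - c / 2) (s / 2) :=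
        mul_le_mul_of_nonneg_left (le_max_left _ _) n.cast_nonneg
      rw [abs_le]
      constructor <;> nlinarith
  refine ⟨hρ, hρ', fun n => Real.log ((C n).toReal - L) + s * n, ?_, ?_⟩
  · refine isLittleO_iff.2 fun c hc => ?_
    filter_upwards [key c hc] with n hn
    obtain ⟨x, hx, hpos, hle⟩ := hn
    rw [hx, EReal.toReal_coe, add_sub_cancel_left, Real.norm_eq_abs, Real.norm_natCast]
    exact hle
  · filter_upwards [key 1 one_pos] with n hn
    obtain ⟨x, hx, hpos, hle⟩ := hn
    rw [hx, EReal.toReal_coe, add_sub_cancel_left]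
    congr 2
    rw [show -s * n + (Real.log x + s * n) = Real.log x by ring, Real.exp_log hpos]


/-! ### Lower and upper bounds on the costs of implementation. -/

section Costs

variable {A X : Type*} [MeasurableSpace X] {μ : A → Measure X} {u : ℝ → ℝ} {wmin : ℝ}
  {c : A → ℝ} {astar ahat : A}

theorem IsMonitoringTechnology.klDiv_ne_top (hμ : IsMonitoringTechnology μ) {a a' : A}
    (h : a ≠ a') : InformationTheory.klDiv (μ a') (μ a) ≠ ⊤ := by
  have := hμ.prob
  exact klDiv_ne_top_of_lintegral_rnDeriv_sq (hμ.absCont a a' h) (hμ.moments a a' h 2 two_pos)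

theorem IsMonitoringTechnology.klDiv_pos (hμ : IsMonitoringTechnology μ) {a a' : A}
    (h : a ≠ a') : 0 < InformationTheory.klDiv (μ a') (μ a) := by
  have := hμ.prob
  rw [pos_iff_ne_zero, ne_eq, InformationTheory.klDiv_eq_zero_iff]
  exact (hμ.identified a a' h).symm

/-- Each competing term is positive because the laws differ, and finiteness of `A` makes the inner
infimum attained. -/
theorem severeRate_pos [Finite A] (hμ : IsMonitoringTechnology μ) (hne : ahat ≠ astar) :
    0 < severeRate μ c astar ahat := by
  have := hμ.prob
  refine lt_min (chernoff_pos (hμ.identified _ _ hne) (hμ.absCont _ _ hne)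
    (hμ.absCont _ _ hne.symm) (hμ.moments _ _ hne 2 two_pos)
    (hμ.moments _ _ hne.symm 2 two_pos)) ?_
  have : Nonempty A := ⟨astar⟩
  obtain ⟨a, ha⟩ := exists_eq_ciInf_of_finite (f := fun a =>
    ⨅ _ : c a < c astar ∧ a ≠ ahat, InformationTheory.klDiv (μ a) (μ astar))
  rw [← ha]
  by_cases h : c a < c astar ∧ a ≠ ahat
  · rw [ciInf_pos h]
    exact hμ.klDiv_pos fun h' => by rw [h'] at h; exact lt_irrefl _ h.1
  · simp [h]

theorem severeRate_ne_top (hμ : IsMonitoringTechnology μ) (hne : ahat ≠ astar) :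
    severeRate μ c astar ahat ≠ ⊤ := by
  have := hμ.prob
  obtain ⟨R, -, hR, -⟩ := exists_chernoff_test (hμ.identified _ _ hne) (hμ.absCont _ _ hne)
    (hμ.absCont _ _ hne.symm) (hμ.moments _ _ hne 2 two_pos) (hμ.moments _ _ hne.symm 2 two_pos)
  exact ne_top_of_le_ne_top ENNReal.ofReal_ne_top ((min_le_left _ _).trans hR)

/-- Markov's inequality for the utility in excess of the utility of the lowest wage. -/
theorem Implements.mul_real_le_integral (hu : IsUtility u wmin) {n : ℕ} {w : (Fin n → X) → ℝ}
    (hμ : ∀ a, IsProbabilityMeasure (μ a)) (hw : Implements μ u wmin c astar n w) (a : A) {y : ℝ}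
    (hy : wmin ≤ y) :
    (u y - u wmin) * (1 - (iidLaw n (μ a)).real {x | w x ≤ y}) ≤
      (∫ x, u (w x) ∂(iidLaw n (μ a))) - u wmin := by
  have hmono := hu.strictMonoOn.monotoneOn
  have hS : MeasurableSet {x | w x ≤ y} := measurableSet_le hw.measurable measurable_const
  rw [← probReal_compl_eq_one_sub hS]
  have hi : Integrable ({x | w x ≤ y}ᶜ.indicator fun _ => u y - u wmin) (iidLaw n (μ a)) :=
    (integrable_const _).indicator hS.compl
  have h := integral_mono hi ((hw.integrable_utility a).sub (integrable_const (u wmin)))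
    fun x => by
      simp only [Pi.sub_apply]
      by_cases hx : x ∈ {x | w x ≤ y}ᶜ
      · rw [Set.indicator_of_mem hx]
        have hx' : y < w x := not_le.1 hx
        linarith [hmono hy (hw.lower_bound x) hx'.le]
      · rw [Set.indicator_of_notMem hx]
        linarith [hmono Set.self_mem_Ici (hw.lower_bound x) (hw.lower_bound x)]
  rw [integral_indicator_const _ hS.compl, integral_sub' (hw.integrable_utility a)
    (integrable_const _), integral_const, probReal_univ, one_smul, smul_eq_mul] at h
  linarith

/-- Incentive compatibility with respect to an action that is easily confused with `astar` keeps
the cost above the first best at any rate faster than the Chernoff distance. -/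
theorem exists_le_cost_of_chernoff_lt (hu : IsUtility u wmin) (hμ : ∀ a, IsProbabilityMeasure (μ a))
    (hcost : c ahat < c astar) {L : ℝ} (hL : wmin ≤ L)
    (huL : u L = u wmin + c astar - c ahat) {r : ℝ}
    (hr : chernoff (μ ahat) (μ astar) < ENNReal.ofReal r) :
    ∃ K : ℝ, 0 < K ∧ ∀ᶠ n : ℕ in atTop, ∀ w, Implements μ u wmin c astar n w →
      L + K * Real.exp (-(n * r)) ≤ ∫ x, w x ∂(iidLaw n (μ astar)) := by
  -- Any utility level strictly between `u wmin` and `u L` would do: acceptance under `ahat` must be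
  -- worth something, and rejection must carry a premium.
  obtain ⟨y, hy, hyL, huy⟩ := hu.exists_eq (v := u wmin + (c astar - c ahat) / 2) hL
    (by linarith) (by linarith)
  obtain ⟨p, κ, hp, hκ, hprem⟩ := hu.exists_premium hy hyL
  set D := c astar - c ahat
  have hD : 0 < D := sub_pos.2 hcost
  refine ⟨min κ (D / 2 / p) / 2, half_pos (lt_min hκ (by positivity)), ?_⟩
  filter_upwards [eventually_le_errors_of_chernoff_lt hr] with n hn w hw
  have hS : MeasurableSet {x | w x ≤ y} := measurableSet_le hw.measurable measurable_const
  have h1 := hn {x | w x ≤ y}ᶜ hS.compl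
  rw [compl_compl, probReal_compl_eq_one_sub hS] at h1
  have h2 := hprem (iidLaw n (μ astar)) w hw.measurable hw.lower_bound hw.integrable_wage
    (hw.integrable_utility astar)
  have h3 := hw.mul_real_le_integral hu hμ ahat hy
  have h4 := hw.ic ahat
  set q := 1 - (iidLaw n (μ ahat)).real {x | w x ≤ y}
  have hq : 0 ≤ q := sub_nonneg.2 measureReal_le_one
  have h5 : D / 2 / p * q ≤ ((∫ x, u (w x) ∂(iidLaw n (μ astar))) - u L) / p := by
    rw [div_mul_eq_mul_div, div_le_div_iff_of_pos_right hp]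
    have : u y - u wmin = D / 2 := by linarith
    rw [this] at h3
    linarith
  set b := (iidLaw n (μ astar)).real {x | w x ≤ y}
  have hb : 0 ≤ b := measureReal_nonneg
  have h6 : min κ (D / 2 / p) * b ≤ κ * b := mul_le_mul_of_nonneg_right (min_le_left _ _) hb
  have h7 : min κ (D / 2 / p) * q ≤ D / 2 / p * q :=
    mul_le_mul_of_nonneg_right (min_le_right _ _) hq
  have h8 := mul_le_mul_of_nonneg_left h1 (lt_min hκ (by positivity : 0 < D / 2 / p)).le
  linarith

/-- An intermediate action keeps the cost above the first best at any rate faster than its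
Kullback-Leibler divergence. -/
theorem exists_le_cost_of_klDiv_lt (hu : IsUtility u wmin) (hμ : ∀ a, IsProbabilityMeasure (μ a))
    {a : A} (hhat : c ahat < c a) (hcost : c a < c astar) {L : ℝ} (hL : wmin ≤ L)
    (huL : u L = u wmin + c astar - c ahat) {r : ℝ}
    (hr : InformationTheory.klDiv (μ a) (μ astar) < ENNReal.ofReal r) :
    ∃ K : ℝ, 0 < K ∧ ∀ᶠ n : ℕ in atTop, ∀ w, Implements μ u wmin c astar n w →
      L + K * Real.exp (-(n * r)) ≤ ∫ x, w x ∂(iidLaw n (μ astar)) := by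
  have hr0 : 0 < r := ENNReal.ofReal_pos.1 (bot_le.trans_lt hr)
  set D := c astar - c ahat
  set Δ := c astar - c a
  have hΔ : 0 < Δ := sub_pos.2 hcost
  have hΔD : Δ < D := sub_lt_sub_left hhat _
  have hD : 0 < D := hΔ.trans hΔD
  -- The threshold must lie within less than `Δ` of `u L`, so that accepting `a` almost surely would
  -- violate its incentive constraint.
  obtain ⟨y, hy, hyL, huy⟩ := hu.exists_eq (v := u wmin + (D - Δ / 4)) hL
    (by linarith) (by linarith)
  obtain ⟨p, κ, hp, hκ, hprem⟩ := hu.exists_premium hy hyL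
  have hpκ : 0 < p + D / κ := by positivity
  -- Chosen so that `p * K + D * (K / κ) = Δ / 8`: the tolerated surplus and the tolerated rejection
  -- probability together use an eighth of `Δ`.
  refine ⟨Δ / (8 * (p + D / κ)), by positivity, ?_⟩
  filter_upwards [eventually_iidLaw_real_le hr (by positivity : 0 < Δ / (8 * D))] with n hn w hw
  set K := Δ / (8 * (p + D / κ))
  have hK : 0 < K := by positivity
  have hKeq : p * K + D * (K / κ) = Δ / 8 := by
    simp only [K]; field_simp
  by_contra! hlt
  have hS : MeasurableSet {x | w x ≤ y} := measurableSet_le hw.measurable measurable_const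
  have h1 := hn _ hS
  have h2 := hprem (iidLaw n (μ astar)) w hw.measurable hw.lower_bound hw.integrable_wage
    (hw.integrable_utility astar)
  have h3 := hw.mul_real_le_integral hu hμ a hy
  have h3' := hw.mul_real_le_integral hu hμ ahat hy
  have h4 := hw.ic a
  have h4' := hw.ic ahat
  set Ea := ∫ x, u (w x) ∂(iidLaw n (μ a))
  set Es := ∫ x, u (w x) ∂(iidLaw n (μ astar))
  set b := (iidLaw n (μ astar)).real {x | w x ≤ y}
  set q := (iidLaw n (μ a)).real {x | w x ≤ y}
  have hb : 0 ≤ b := measureReal_nonneg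
  have hq : 0 ≤ q := measureReal_nonneg
  -- Incentive compatibility against `ahat`, whose expected utility is at least `u wmin`, makes the
  -- surplus nonnegative, so the premium term alone is bounded by the excess cost.
  have hEs : 0 ≤ (Es - u L) / p := by
    refine div_nonneg ?_ hp.le
    have : 0 ≤ (u y - u wmin) * (1 - (iidLaw n (μ ahat)).real {x | w x ≤ y}) :=
      mul_nonneg (by linarith) (sub_nonneg.2 measureReal_le_one)
    linarith
  have hexp1 : Real.exp (-(n * r)) ≤ 1 := Real.exp_le_one_iff.2 (by
    have := mul_nonneg (n.cast_nonneg (α := ℝ)) hr0.le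
    linarith)
  have hexp := Real.exp_pos (n * r)
  have hinv : Real.exp (-(n * r)) * Real.exp (n * r) = 1 := by rw [← Real.exp_add]; simp
  have hEs' : Es - u L ≤ p * K := by
    have : (Es - u L) / p ≤ K := by nlinarith [mul_nonneg hκ.le hb]
    rw [div_le_iff₀ hp] at this
    linarith
  have hq' : q ≤ K / κ + Δ / (8 * D) := by
    have hκb : κ * b ≤ K * Real.exp (-(n * r)) := by linarith
    have : Real.exp (n * r) * b ≤ K / κ := by
      rw [le_div_iff₀ hκ]
      calc Real.exp (n * r) * b * κ = Real.exp (n * r) * (κ * b) := by ring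
        _ ≤ Real.exp (n * r) * (K * Real.exp (-(n * r))) :=
          mul_le_mul_of_nonneg_left hκb hexp.le
        _ = K * (Real.exp (-(n * r)) * Real.exp (n * r)) := by ring
        _ = K := by rw [hinv, mul_one]
    linarith
  have hDq : D * q ≤ D * (K / κ) + Δ / 8 := by
    have := mul_le_mul_of_nonneg_left hq' hD.le
    have h8 : D * (Δ / (8 * D)) = Δ / 8 := by field_simp
    linarith
  have huy' : u y - u wmin = D - Δ / 4 := by linarith
  rw [huy'] at h3
  have hΔq := mul_nonneg hΔ.le hq
  have hΔ' : c astar - c a = Δ := rfl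
  have hD' : c astar - c ahat = D := rfl
  -- The incentive constraint for `a` gives `3 Δ / 4 ≤ (Es - u L) + D q`, while the right side is at
  -- most `Δ / 4`.
  nlinarith

theorem exists_le_secondBestCost (hu : IsUtility u wmin) (hμ : ∀ a, IsProbabilityMeasure (μ a))
    (hcost : c ahat < c astar) (hhat : ∀ a, a ≠ ahat → c ahat < c a) {L : ℝ} (hL : wmin ≤ L)
    (huL : u L = u wmin + c astar - c ahat) {r : ℝ}
    (hr : severeRate μ c astar ahat < ENNReal.ofReal r) :
    ∃ K : ℝ, 0 < K ∧ ∀ᶠ n : ℕ in atTop,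
      ((L + K * Real.exp (-(n * r)) : ℝ) : EReal) ≤ secondBestCost μ u wmin c astar n := by
  have key : ∃ K : ℝ, 0 < K ∧ ∀ᶠ n : ℕ in atTop, ∀ w, Implements μ u wmin c astar n w →
      L + K * Real.exp (-(n * r)) ≤ ∫ x, w x ∂(iidLaw n (μ astar)) := by
    rcases min_lt_iff.1 hr with h | h
    · exact exists_le_cost_of_chernoff_lt hu hμ hcost hL huL h
    · obtain ⟨a, h⟩ := iInf_lt_iff.1 h
      obtain ⟨⟨ha, hne⟩, h⟩ := iInf_lt_iff.1 h
      exact exists_le_cost_of_klDiv_lt hu hμ (hhat a hne) ha hL huL h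
  obtain ⟨K, hK, h⟩ := key
  refine ⟨K, hK, h.mono fun n hn => le_iInf₂ fun w hw => EReal.coe_le_coe_iff.2 (hn w hw)⟩

/-- Acceptance regions that are rejected under `astar`, and accepted under `ahat`, with
probability of order `exp (-n r)`, and that all other cheaper actions pass with vanishing
probability. -/
theorem exists_acceptance_regions [Finite A] (hμ : IsMonitoringTechnology μ)
    (hne : ahat ≠ astar) {r : ℝ} (hr0 : 0 < r)
    (hr : ENNReal.ofReal r < severeRate μ c astar ahat) :
    ∃ K : ℝ, 0 < K ∧ ∃ S : ∀ n : ℕ, Set (Fin n → X), (∀ n, MeasurableSet (S n)) ∧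
      (∀ n, (iidLaw n (μ astar)).real (S n)ᶜ + (iidLaw n (μ ahat)).real (S n) ≤
        K * Real.exp (-(n * r))) ∧
      ∀ a, c a < c astar → Tendsto (fun n => (iidLaw n (μ a)).real (S n)) atTop (𝓝 0) := by
  have := hμ.prob
  have := Fintype.ofFinite A
  obtain ⟨R, hR, hchR, S₀, hS₀⟩ := exists_chernoff_test (hμ.identified _ _ hne)
    (hμ.absCont _ _ hne) (hμ.absCont _ _ hne.symm) (hμ.moments _ _ hne 2 two_pos)
    (hμ.moments _ _ hne.symm 2 two_pos)
  have hrR : r < R := (ENNReal.ofReal_lt_ofReal_iff hR).1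
    ((lt_min_iff.1 hr).1.trans_le hchR)
  have hexp : ∀ n : ℕ, Real.exp (-(n * R)) ≤ Real.exp (-(n * r)) := fun n =>
    Real.exp_le_exp.2 (neg_le_neg (mul_le_mul_of_nonneg_left hrR.le n.cast_nonneg))
  have htest : ∀ a, ∃ S : ∀ n : ℕ, Set (Fin n → X), (∀ n, MeasurableSet (S n)) ∧
      (∀ n, (iidLaw n (μ astar)).real (S n)ᶜ ≤ Real.exp (-(n * r))) ∧
      (c a < c astar ∧ a ≠ ahat →
        Tendsto (fun n => (iidLaw n (μ a)).real (S n)) atTop (𝓝 0)) := by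
    intro a
    by_cases ha : c a < c astar ∧ a ≠ ahat
    · have has : a ≠ astar := fun h => by rw [h] at ha; exact lt_irrefl _ ha.1
      obtain ⟨S, h1, h2, h3⟩ := exists_stein_test (hμ.absCont _ _ has)
        (hμ.klDiv_ne_top has.symm) ((lt_min_iff.1 hr).2.trans_le (iInf₂_le a ha))
      exact ⟨S, h1, h2, fun _ => h3⟩
    -- Actions needing no Stein test get the trivial one, so that the intersection can run over all
    -- of `A`.
    · exact ⟨fun n => Set.univ, fun n => MeasurableSet.univ,
        fun n => by simpa using Real.exp_nonneg _, fun h => absurd h ha⟩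
  choose S hSm hS1 hS2 using htest
  have hlim : Tendsto (fun n : ℕ => Real.exp (-(n * r))) atTop (𝓝 0) :=
    Real.tendsto_exp_neg_atTop_nhds_zero.comp (tendsto_natCast_atTop_atTop.atTop_mul_const hr0)
  have hhat : ∀ n, (iidLaw n (μ ahat)).real (S₀ n ∩ ⋂ a, S a n) ≤ Real.exp (-(n * r)) := fun n =>
    (measureReal_mono Set.inter_subset_left).trans ((hS₀ n).2.1.trans (hexp n))
  -- One unit per Stein test, and two for the errors of the Chernoff test.
  refine ⟨Fintype.card A + 2, by positivity, fun n => S₀ n ∩ ⋂ a, S a n, fun n =>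
    (hS₀ n).1.inter (MeasurableSet.iInter fun a => hSm a n), fun n => ?_, fun a ha => ?_⟩
  · have h1 : (iidLaw n (μ astar)).real (S₀ n ∩ ⋂ a, S a n)ᶜ ≤
        Real.exp (-(n * r)) + ∑ a : A, Real.exp (-(n * r)) := by
      rw [Set.compl_inter, Set.compl_iInter]
      refine (measureReal_union_le _ _).trans (add_le_add ((hS₀ n).2.2.trans (hexp n)) ?_)
      exact (measureReal_iUnion_fintype_le _).trans (Finset.sum_le_sum fun a _ => hS1 a n)
    rw [Finset.sum_const, nsmul_eq_mul, Finset.card_univ] at h1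
    linarith [hhat n]
  · by_cases h : a = ahat
    · rw [h]
      exact squeeze_zero (fun n => measureReal_nonneg) hhat hlim
    · exact squeeze_zero (fun n => measureReal_nonneg) (fun n => measureReal_mono
        (Set.inter_subset_right.trans (Set.iInter_subset _ a))) (hS2 a ⟨ha, h⟩)

theorem integral_piecewise_const {Ω : Type*} [MeasurableSpace Ω] (P : Measure Ω)
    [IsProbabilityMeasure P] {S : Set Ω} (hS : MeasurableSet S)
    [DecidablePred (· ∈ S)] (s t : ℝ) :
    Integrable (S.piecewise (fun _ => s) fun _ => t) P ∧
      ∫ x, S.piecewise (fun _ => s) (fun _ => t) x ∂P = t + (s - t) * P.real S := by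
  have hi : Integrable (S.indicator fun _ : Ω => s - t) P := (integrable_const _).indicator hS
  have h : S.piecewise (fun _ => s) (fun _ => t) = fun x => t + S.indicator (fun _ => s - t) x := by
    ext x
    by_cases hx : x ∈ S <;> simp [hx]
  rw [h]
  refine ⟨(integrable_const t).add hi, ?_⟩
  rw [integral_add (integrable_const t) hi, integral_indicator_const _ hS]
  simp [mul_comm]

/-- The binary contract that pays `wH` on the acceptance region `S` and the lowest wage
otherwise. -/
theorem binaryCost_le (hμ : ∀ a, IsProbabilityMeasure (μ a)) {n : ℕ}
    {S : Set (Fin n → X)} (hS : MeasurableSet S) {wH : ℝ} (hwH : wmin < wH)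
    (hne : S.Nonempty) (hne' : Sᶜ.Nonempty)
    (hic : ∀ a, (u wH - u wmin) * (iidLaw n (μ a)).real S - c a ≤
      (u wH - u wmin) * (iidLaw n (μ astar)).real S - c astar)
    (hir : c astar ≤ u wmin + (u wH - u wmin) * (iidLaw n (μ astar)).real S) :
    binaryCost μ u wmin c astar n ≤ (wH : EReal) := by
  classical
  set w : (Fin n → X) → ℝ := S.piecewise (fun _ => wH) fun _ => wmin
  have huw : (fun x => u (w x)) = S.piecewise (fun _ => u wH) fun _ => u wmin := by
    ext x
    by_cases hx : x ∈ S <;> simp [w, hx]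
  have hint := fun a => integral_piecewise_const (iidLaw n (μ a)) hS (u wH) (u wmin)
  have hwint := integral_piecewise_const (iidLaw n (μ astar)) hS wH wmin
  have himp : Implements μ u wmin c astar n w :=
    { measurable := measurable_const.piecewise hS measurable_const
      lower_bound := fun x => by
        by_cases hx : x ∈ S <;> simp [w, hx, hwH.le]
      integrable_wage := hwint.1
      integrable_utility := fun a => by rw [huw]; exact (hint a).1
      ic := fun a => by
        rw [huw, (hint a).2, (hint astar).2]
        linarith [hic a]
      ir := by
        rw [huw, (hint astar).2]
        linarith }
  have hrange : Set.range w = {wH, wmin} := by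
    simp only [w, Set.range_piecewise]
    rw [hne.image_const, hne'.image_const]
    rfl
  refine (iInf₂_le w ⟨himp, by rw [hrange]; exact Set.ncard_pair hwH.ne'⟩).trans
    (EReal.coe_le_coe_iff.2 ?_)
  rw [hwint.2]
  nlinarith [measureReal_le_one (μ := iidLaw n (μ astar)) (s := S)]

/-- Only `ahat` needs errors of order `ε`: for an intermediate action the reward exceeds the cost
saving by a fixed margin, and for a dearer one the extra cost is fixed while the gain is `O(ε)`. The
reference wage `b` gives chord slopes and utility bounds independent of `n`. -/
theorem exists_binaryCost_le [Finite A] (hu : IsUtility u wmin) (hμ : IsMonitoringTechnology μ)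
    (hcost : c ahat < c astar) (hdist : ∀ a, a ≠ astar → c a ≠ c astar)
    (hhat : ∀ a, a ≠ ahat → c ahat < c a) (hsev : c ahat ≤ u wmin) {L b : ℝ} (hL : wmin ≤ L)
    (huL : u L = u wmin + c astar - c ahat) (hLb : L < b) {r : ℝ} (hr0 : 0 < r)
    (hr : ENNReal.ofReal r < severeRate μ c astar ahat) :
    ∃ K : ℝ, ∀ᶠ n : ℕ in atTop,
      binaryCost μ u wmin c astar n ≤ ((L + K * Real.exp (-(n * r)) : ℝ) : EReal) := by
  have hne : ahat ≠ astar := fun h => by rw [h] at hcost; exact lt_irrefl _ hcost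
  have := hμ.prob
  obtain ⟨K, hK, S, hSm, hS1, hS2⟩ := exists_acceptance_regions hμ hne hr0 hr
  set D := c astar - c ahat
  have hD : 0 < D := sub_pos.2 hcost
  have hmono := hu.strictMonoOn
  have hb : wmin ≤ b := hL.trans hLb.le
  have hub : u L < u b := hmono hL hb hLb
  set s := (u b - u L) / (b - L)
  have hs : 0 < s := div_pos (sub_pos.2 hub) (sub_pos.2 hLb)
  have hlim : Tendsto (fun n : ℕ => K * Real.exp (-(n * r))) atTop (𝓝 0) := by
    have h : Tendsto (fun n : ℕ => Real.exp (-(n * r))) atTop (𝓝 0) :=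
      Real.tendsto_exp_neg_atTop_nhds_zero.comp (tendsto_natCast_atTop_atTop.atTop_mul_const hr0)
    simpa using h.const_mul K
  -- Raising the wage by `2 D ε / s` raises utility by at least `2 D ε`, and `D (1 + 2 ε) (1 - ε) ≥
  -- D` once `ε ≤ 1 / 2`; this is the constraint against `ahat`.
  refine ⟨2 * D / s * K, ?_⟩
  have hcheap : ∀ᶠ n : ℕ in atTop, ∀ a, c a < c astar → a ≠ ahat →
      K * Real.exp (-(n * r)) + (iidLaw n (μ a)).real (S n) < 1 - (c astar - c a) / D := by
    refine eventually_all.2 fun a => ?_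
    by_cases ha : c a < c astar ∧ a ≠ ahat
    · have hpos : 0 < 1 - (c astar - c a) / D := by
        rw [sub_pos, div_lt_one hD]
        exact sub_lt_sub_left (hhat a ha.2) _
      have h := hlim.add (hS2 a ha.1)
      rw [add_zero] at h
      exact (h.eventually (gt_mem_nhds hpos)).mono fun n hn _ _ => hn
    · exact Eventually.of_forall fun n h1 h2 => absurd ⟨h1, h2⟩ ha
  have hdear : ∀ᶠ n : ℕ in atTop, ∀ a, c astar < c a →
      (u b - u wmin) * (K * Real.exp (-(n * r))) < c a - c astar := by
    refine eventually_all.2 fun a => ?_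
    by_cases ha : c astar < c a
    · have h := hlim.const_mul (u b - u wmin)
      rw [mul_zero] at h
      exact (h.eventually (gt_mem_nhds (sub_pos.2 ha))).mono fun n hn _ => hn
    · exact Eventually.of_forall fun n h => absurd h ha
  have hsmall : ∀ᶠ n : ℕ in atTop, 2 * D / s * (K * Real.exp (-(n * r))) < b - L := by
    have h := hlim.const_mul (2 * D / s)
    rw [mul_zero] at h
    exact h.eventually (gt_mem_nhds (sub_pos.2 hLb))
  filter_upwards [hlim.eventually (gt_mem_nhds (by norm_num : (0 : ℝ) < 1 / 2)), hcheap, hdear,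
    hsmall] with n hhalf hcheap hdear hsmall
  set ε := K * Real.exp (-(n * r))
  have hε : 0 < ε := mul_pos hK (Real.exp_pos _)
  have herr := hS1 n
  rw [probReal_compl_eq_one_sub (hSm n)] at herr
  set wH := L + 2 * D / s * ε
  have hwHL : L < wH := lt_add_of_pos_right _ (by positivity)
  have hchord := hu.le_of_mem_chord hL hLb hwHL.le (by simp only [wH]; linarith : wH ≤ b)
  have hwH : wmin < wH := hL.trans_lt hwHL
  have hubH : u wH ≤ u b := hmono.monotoneOn hwH.le hb (by simp only [wH]; linarith)
  have hinc : u wmin + D + 2 * D * ε ≤ u wH := by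
    have : s * (wH - L) = 2 * D * ε := by simp only [wH]; field_simp; ring
    linarith
  set v := u wH - u wmin
  have hv : D + 2 * D * ε ≤ v := by simp only [v]; linarith
  have hDε : 0 < D * ε := mul_pos hD hε
  have hvD : D ≤ v := by linarith
  have hvpos : 0 < v := hD.trans_le hvD
  set P := (iidLaw n (μ astar)).real (S n)
  have hP1 : P ≤ 1 := measureReal_le_one
  have hnn : ∀ a, 0 ≤ (iidLaw n (μ a)).real (S n) := fun a => measureReal_nonneg
  have hPε : 1 - ε ≤ P := by linarith [hnn ahat]
  have hichat : D ≤ v * (P - (iidLaw n (μ ahat)).real (S n)) := by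
    have h1 : v * (1 - ε) ≤ v * (P - (iidLaw n (μ ahat)).real (S n)) :=
      mul_le_mul_of_nonneg_left (by linarith) hvpos.le
    have h2 : (D + 2 * D * ε) * (1 - ε) ≤ v * (1 - ε) :=
      mul_le_mul_of_nonneg_right hv (by linarith)
    nlinarith
  have hD' : D = c astar - c ahat := rfl
  rw [mul_assoc]
  refine binaryCost_le hμ.prob (hSm n) hwH ?_ ?_ (fun a => ?_) ?_
  -- Errors below one half exclude trivial regions, so the contract really takes two values.
  · rw [Set.nonempty_iff_ne_empty]
    intro h
    have : P = 0 := by simp only [P, h, measureReal_empty]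
    linarith
  · rw [Set.nonempty_iff_ne_empty]
    intro h
    have : (iidLaw n (μ ahat)).real (S n) = 1 := by
      rw [Set.compl_empty_iff.1 h, probReal_univ]
    linarith
  · show v * _ - c a ≤ v * P - c astar
    rcases lt_trichotomy (c a) (c astar) with ha | ha | ha
    · by_cases hah : a = ahat
      · rw [hah]; linarith
      · have h1 := hcheap a ha hah
        have h2 : (c astar - c a) / D ≤ P - (iidLaw n (μ a)).real (S n) := by linarith
        have h3 : c astar - c a ≤ D * (P - (iidLaw n (μ a)).real (S n)) := by
          rwa [div_le_iff₀' hD] at h2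
        have h4 : 0 ≤ P - (iidLaw n (μ a)).real (S n) :=
          (div_nonneg (sub_pos.2 ha).le hD.le).trans h2
        nlinarith
    · have : a = astar := by
        by_contra h
        exact hdist a h ha
      rw [this]
    · have h1 := hdear a ha
      have h2 : v * ε ≤ (u b - u wmin) * ε :=
        mul_le_mul_of_nonneg_right (by simp only [v]; linarith) hε.le
      have h3 : (iidLaw n (μ a)).real (S n) ≤ 1 := measureReal_le_one
      nlinarith
  -- Participation follows from the constraint against `ahat` and `c ahat ≤ u wmin`.
  · show c astar ≤ u wmin + v * P
    have := mul_nonneg hvpos.le (hnn ahat)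
    linarith

theorem firstBest_and_rates [Finite A] (hu : IsUtility u wmin) (hμ : IsMonitoringTechnology μ)
    (hcost : ∃ a, c a < c astar) (hdist : ∀ a, a ≠ astar → c a ≠ c astar)
    (hhat : ∀ a, a ≠ ahat → c ahat < c a) (hsev : c ahat ≤ u wmin)
    (hrich : ∃ w, wmin ≤ w ∧ u wmin + c astar - c ahat < u w) :
    firstBestCost u wmin c astar =
        ((invUtility u wmin (u wmin + c astar - c ahat) : ℝ) : EReal) ∧
      ConvergesAtRate (secondBestCost μ u wmin c astar)
        (invUtility u wmin (u wmin + c astar - c ahat)) (severeRate μ c astar ahat) ∧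
      ConvergesAtRate (binaryCost μ u wmin c astar)
        (invUtility u wmin (u wmin + c astar - c ahat)) (severeRate μ c astar ahat) := by
  have hle : ∀ a, c ahat ≤ c a := fun a => by
    by_cases h : a = ahat
    · rw [h]
    · exact (hhat a h).le
  obtain ⟨a₀, ha₀⟩ := hcost
  have hcost : c ahat < c astar := (hle a₀).trans_lt ha₀
  have hne : ahat ≠ astar := fun h => by rw [h] at hcost; exact lt_irrefl _ hcost
  obtain ⟨b, hb, hub⟩ := hrich
  obtain ⟨L, hL, hLb, huL⟩ := hu.exists_eq hb (by linarith) hub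
  rw [← huL, hu.invUtility_eq hL]
  have hSB : ∀ n, secondBestCost μ u wmin c astar n ≤ binaryCost μ u wmin c astar n := fun n =>
    le_iInf₂ fun w hw => iInf₂_le w hw.1
  have hup := fun (r : ℝ) (hr0 : 0 < r) hr =>
    exists_binaryCost_le (r := r) hu hμ hcost hdist hhat hsev hL huL hLb hr0 hr
  have hlow := fun (r : ℝ) hr =>
    exists_le_secondBestCost (r := r) hu hμ.prob hcost hhat hL huL hr
  refine ⟨hu.firstBestCost_eq hne hle hsev hL huL,
    convergesAtRate_of_bounds (severeRate_pos hμ hne) (severeRate_ne_top hμ hne) ?_ hlow,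
    convergesAtRate_of_bounds (severeRate_pos hμ hne) (severeRate_ne_top hμ hne) hup ?_⟩
  · intro r hr0 hr
    obtain ⟨K, hK⟩ := hup r hr0 hr
    exact ⟨K, hK.mono fun n hn => (hSB n).trans hn⟩
  · intro r hr
    obtain ⟨K, hK, h⟩ := hlow r hr
    exact ⟨K, hK, h.mono fun n hn => hn.trans (hSB n)⟩

/-- With two actions there is no intermediate one, so the inner infimum is `⊤`. -/
theorem severeRate_fin_two {μ : Fin 2 → Measure X} {c : Fin 2 → ℝ} :
    severeRate μ c 1 0 = chernoff (μ 0) (μ 1) := by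
  refine min_eq_left (le_iInf₂ fun a ha => ?_)
  fin_cases a
  · exact absurd rfl ha.2
  · exact absurd ha.1 (lt_irrefl _)

end Costs

end MoralHazard

theorem theorem2 {d : ℕ} (X : Set (EuclideanSpace ℝ (Fin d))) (u : ℝ → ℝ) (wmin : ℝ)
    (hu : MoralHazard.IsUtility u wmin) :
    -- binary actions `0` and `1`, with target action `1`
    (∀ (μ : Fin 2 → Measure X) (c : Fin 2 → ℝ),
      MoralHazard.IsMonitoringTechnology μ →
      c 0 < c 1 →
      c 0 ≤ u wmin →
      (∃ w, wmin ≤ w ∧ u wmin + c 1 - c 0 < u w) →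
      MoralHazard.firstBestCost u wmin c 1 =
          ((MoralHazard.invUtility u wmin (u wmin + c 1 - c 0) : ℝ) : EReal) ∧
        MoralHazard.ConvergesAtRate (MoralHazard.secondBestCost μ u wmin c 1)
          (MoralHazard.invUtility u wmin (u wmin + c 1 - c 0))
          (MoralHazard.chernoff (μ 0) (μ 1)) ∧
        MoralHazard.ConvergesAtRate (MoralHazard.binaryCost μ u wmin c 1)
          (MoralHazard.invUtility u wmin (u wmin + c 1 - c 0))
          (MoralHazard.chernoff (μ 0) (μ 1))) ∧
    -- a general finite action set, with target action `astar` and unique cheapest action `ahat`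
    (∀ (A : Type*) [Finite A] (μ : A → Measure X) (c : A → ℝ) (astar ahat : A),
      MoralHazard.IsMonitoringTechnology μ →
      (∃ a, c a < c astar) →
      (∀ a, a ≠ astar → c a ≠ c astar) →
      (∀ a, a ≠ ahat → c ahat < c a) →
      c ahat ≤ u wmin →
      (∃ w, wmin ≤ w ∧ u wmin + c astar - c ahat < u w) →
      MoralHazard.firstBestCost u wmin c astar =
          ((MoralHazard.invUtility u wmin (u wmin + c astar - c ahat) : ℝ) : EReal) ∧
        MoralHazard.ConvergesAtRate (MoralHazard.secondBestCost μ u wmin c astar)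
          (MoralHazard.invUtility u wmin (u wmin + c astar - c ahat))
          (MoralHazard.severeRate μ c astar ahat) ∧
        MoralHazard.ConvergesAtRate (MoralHazard.binaryCost μ u wmin c astar)
          (MoralHazard.invUtility u wmin (u wmin + c astar - c ahat))
          (MoralHazard.severeRate μ c astar ahat)) := by
  refine ⟨fun μ c hμ hc hsev hrich => ?_, fun A _ μ c astar ahat hμ hcost hdist hhat hsev hrich =>
    MoralHazard.firstBest_and_rates hu hμ hcost hdist hhat hsev hrich⟩
  have h := MoralHazard.firstBest_and_rates (astar := 1) (ahat := 0) hu hμ ⟨0, hc⟩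
    (fun a ha => by fin_cases a; exacts [hc.ne, absurd rfl ha])
    (fun a ha => by fin_cases a; exacts [absurd rfl ha, hc]) hsev hrich
  rwa [MoralHazard.severeRate_fin_two] at h
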